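/- For every $m\in\mathbb N$ let $P_m$ be a probability measure under which $[0,1]$-valued p-values $p_{1,m},\dots,p_{m,m}$ of $m$ hypotheses are given, and let $\{1,\dots,m\}=I_{0,m}\,\dot\cup\,I_{1,m}$ be the nonrandom partition into true and false null hypotheses, $m_0=\#I_{0,m}$. Assume the basic independence model: the vectors $(p_{i,m})_{i\in I_{0,m}}$ and $(p_{i,m})_{i\in I_{1,m}}$ are independent, the $p_{i,m}$, $i\in I_{0,m}$, are independent and uniformly distributed on $[0,1]$, and the dependence among the $p_{i,m}$, $i\in I_{1,m}$, is arbitrary. Let $0<\alpha_1<\alpha_2\le\lambda<1$. Let $R_m(t)=\#\{i\le m: p_{i,m}\le t\}$ and $\widehat F_m(t)=R_m(t)/m$. For each level $\alpha\in(\alpha_1,\alpha_2)$ and each $m$ let $\widehat m_0=\widehat m_{0,\alpha}$ be an estimator that is a measurable function of $(\widehat F_m(t))_{t\ge\lambda}$ only (it may, but need not, depend on $\alpha$). The adaptive step-up test at level $\alpha$ has the critical values $\widehat\alpha_{i:m}=\min\{\tfrac{i}{\widehat m_0}\alpha,\lambda\}$, $0\le i\le m$. With the ordered p-values $p_{1:m}\le\dots\le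 p_{m:m}$ and $p_{0:m}:=0$ let $$R_{m,\alpha}=\max\{i\in\{0,\dots,m\}: p_{i:m}\le\widehat\alpha_{i:m}\},\qquad V_{m,\alpha}=\#\{i\in I_{0,m}: p_{i,m}\le\widehat\alpha_{R_{m,\alpha}:m}\}$$ be the numbers of rejections and of false rejections. Suppose that * (A1) $m_0/m\to\kappa_0$ for some $\kappa_0\in(0,1]$; * (A2) for every $\alpha\in(\alpha_1,\alpha_2)$ and all $m$, $\widehat m_{0,\alpha}>0$ and $\frac{\lambda}{\alpha}\widehat m_{0,\alpha}\ge R_m(\lambda)$; * (A3) for every $\alpha\in(\alpha_1,\alpha_2)$ there is $K>0$ with $\widehat m_{0,\alpha}\le Km$ for all $m$; * (consistency) for every $\alpha\in(\alpha_1,\alpha_2)$, with $0/0:=0$, $$\frac{V_{m,\alpha}}{R_{m,\alpha}}-\mathbb E\Bigl(\frac{V_{m,\alpha}}{R_{m,\alpha}}\Bigr)\to0\quad\text{in }P_m\text{-probability as } m\to\infty.$$ Then for every $\alpha\in(\alpha_1,\alpha_2)$, as $m\to\infty$, $V_{m,\alpha}\to\infty$ and $R_{m,\alpha}\to\infty$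 in $P_m$-probability, i.e. $P_m(V_{m,\alpha}\le C)\to0$ and $P_m(R_{m,\alpha}\le C)\to0$ for every $C\in\mathbb R$. -/

import Mathlib

open MeasureTheory ProbabilityTheory Filter Topology

namespace AdaptiveStepUp

noncomputable section

/-- `R_m(t)`: the number of p-values that are at most `t`. -/
def countLE {m : ℕ} (x : Fin m → ℝ) (t : ℝ) : ℕ :=
  (Finset.univ.filter fun i => x i ≤ t).card

/-- The empirical distribution function of the p-values `x`. -/
def ecdf {m : ℕ} (x : Fin m → ℝ) (t : ℝ) : ℝ := (countLE x t : ℝ) / m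

/-- The path `(F̂_m(t))_{t ≥ lam}` of the empirical distribution function. -/
def ecdfTail (lam : ℝ) {m : ℕ} (x : Fin m → ℝ) : Set.Ici lam → ℝ := fun t => ecdf x t

/-- The order statistics `x_{1:m} ≤ … ≤ x_{m:m}`, with the convention `x_{0:m} = 0`
(indices above `m` are never used). -/
def orderStat {m : ℕ} (x : Fin m → ℝ) (i : ℕ) : ℝ :=
  if h : 1 ≤ i ∧ i ≤ m then x (Tuple.sort x ⟨i - 1, by omega⟩) else 0

/-- The critical values `α_{i:m} = min {(i / m̂₀) α, lam}`; in particular `α_{0:m} = 0` if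
`lam ≥ 0`. -/
def critVal (α lam mhat : ℝ) (i : ℕ) : ℝ := min ((i : ℝ) / mhat * α) lam

/-- The number of rejections of the step-up test with critical values `c`:
the largest `i ∈ {0, …, m}` with `x_{i:m} ≤ c i`. -/
def stepUpR {m : ℕ} (x : Fin m → ℝ) (c : ℕ → ℝ) : ℕ :=
  Nat.findGreatest (fun i => orderStat x i ≤ c i) m

/-- The number of false rejections of the step-up test with critical values `c`:
hypothesis `i` is rejected iff `x i ≤ c R`, where `R` is the number of rejections. -/
def stepUpV {m : ℕ} (I0 : Finset (Fin m)) (x : Fin m → ℝ) (c : ℕ → ℝ) : ℕ :=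
  (I0.filter fun i => x i ≤ c (stepUpR x c)).card

/-- The data driven critical values of the adaptive test at level `α`, whose estimator `m̂₀` of
the number of true nulls is the functional `g` of `(F̂_m(t))_{t ≥ lam}`. -/
def adaptiveCrit (α lam : ℝ) (g : (Set.Ici lam → ℝ) → ℝ) {m : ℕ} (x : Fin m → ℝ) : ℕ → ℝ :=
  critVal α lam (g (ecdfTail lam x))

/-- `R_{m,α}`: the number of rejections of the adaptive step-up test. -/
def numRej (α lam : ℝ) (g : (Set.Ici lam → ℝ) → ℝ) {m : ℕ} (x : Fin m → ℝ) : ℕ :=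
  stepUpR x (adaptiveCrit α lam g x)

/-- `V_{m,α}`: the number of false rejections of the adaptive step-up test. -/
def numFalseRej (α lam : ℝ) (g : (Set.Ici lam → ℝ) → ℝ) {m : ℕ} (I0 : Finset (Fin m))
    (x : Fin m → ℝ) : ℕ :=
  stepUpV I0 x (adaptiveCrit α lam g x)

/-- The false discovery proportion `V_{m,α} / R_{m,α}`, with `0 / 0 = 0`. -/
def fdp (α lam : ℝ) (g : (Set.Ici lam → ℝ) → ℝ) {m : ℕ} (I0 : Finset (Fin m))
    (x : Fin m → ℝ) : ℝ :=
  (numFalseRej α lam g I0 x : ℝ) / (numRej α lam g x : ℝ)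

/-- The basic independence model: `p i` is the p-value of the `i`-th hypothesis, and `I0` is the
set of true nulls. -/
structure IsBI {Ω : Type*} [MeasurableSpace Ω] (P : Measure Ω) {m : ℕ} (I0 : Finset (Fin m))
    (p : Fin m → Ω → ℝ) : Prop where
  measurable : ∀ i, Measurable (p i)
  mem_Icc : ∀ i ω, p i ω ∈ Set.Icc (0 : ℝ) 1
  indep_blocks : IndepFun (fun ω (i : {i // i ∈ I0}) => p i ω)
    (fun ω (i : {i // i ∉ I0}) => p i ω) P
  indep_null : iIndepFun (fun (i : {i // i ∈ I0}) => p i) P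
  unif_null : ∀ i ∈ I0, ∀ t ∈ Set.Icc (0 : ℝ) 1, P {ω | p i ω ≤ t} = ENNReal.ofReal t

/-- `X_m → 0` in `P_m`-probability; each `X_m` lives on its own probability space. -/
def TendstoZeroInProb {Ω : ℕ → Type*} [∀ m, MeasurableSpace (Ω m)] (P : ∀ m, Measure (Ω m))
    (X : ∀ m, Ω m → ℝ) : Prop :=
  ∀ ε : ℝ, 0 < ε → Tendsto (fun m => P m {ω | ε ≤ |X m ω|}) atTop (𝓝 0)

/-- `X_m → ∞` in `P_m`-probability. -/
def TendstoInftyInProb {Ω : ℕ → Type*} [∀ m, MeasurableSpace (Ω m)] (P : ∀ m, Measure (Ω m))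
    (X : ∀ m, Ω m → ℝ) : Prop :=
  ∀ C : ℝ, Tendsto (fun m => P m {ω | X m ω ≤ C}) atTop (𝓝 0)

/-- Consistency of a sequence of tests with false discovery proportions `F m`:
`F m - E (F m) → 0` in `P_m`-probability. -/
def Consistent {Ω : ℕ → Type*} [∀ m, MeasurableSpace (Ω m)] (P : ∀ m, Measure (Ω m))
    (F : ∀ m, Ω m → ℝ) : Prop :=
  TendstoZeroInProb P fun m ω => F m ω - ∫ ω', F m ω' ∂(P m)

end

end AdaptiveStepUp

namespace AdaptiveStepUp

/-! The estimator sees the p-values only through the empirical distribution function from `lam` on,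
so moving one p-value inside `[0, lam]` leaves all critical values fixed. Resampling single true
nulls, which are uniform and independent of the rest, yields two estimates.

First, the false discovery rate stays away from zero. Fix the other p-values and let one null
p-value grow from 0: the number of rejections `R` stays constant until the p-value passes the
critical value `R α / m̂₀`, so this null contributes at least `α / m̂₀ ≥ α / (K m)`. Summing over
the nulls gives a bound of order `m₀ / m` (`IsAdmissible.le_integral_fdp`). As the proportion is 0
on `V = 0`, consistency forces `P (V = 0) → 0`.

Second, `R ≤ C` is not much likelier than `V = 0`. If at least `n` p-values are at most `lam`, the
lower bound on `m̂₀` puts the rejection threshold below `a = C lam / n` whenever `R ≤ C`. Pushing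
one null p-value out of `[0, a]` into `(a, lam]` keeps `R ≤ C` and costs a factor `1 + a / (lam -
a)`; once all nulls have been pushed, `V = 0`. With `n` of order `m₀`, which Chebyshev's inequality
permits, the product of the `m₀` factors is bounded (`IsAdmissible.measure_numRej_le`).

Hence `R → ∞` in probability. Consistency keeps `V / R` above half the lower bound for its mean, so
`V → ∞` as well (`tendstoInftyInProb_of_consistent`). -/

/-! ### Counting functions and deterministic step-up tests -/

lemma countLE_le {m : ℕ} (x : Fin m → ℝ) (t : ℝ) : countLE x t ≤ m := by
  simpa [countLE] using Finset.card_filter_le (Finset.univ : Finset (Fin m)) fun i => x i ≤ t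

lemma countLE_mono {m : ℕ} (x : Fin m → ℝ) : Monotone (countLE x) := fun _ _ h =>
  Finset.card_le_card (Finset.monotone_filter_right _ fun _ _ hi => hi.trans h)

lemma countLE_anti {m : ℕ} {x y : Fin m → ℝ} (h : x ≤ y) (t : ℝ) : countLE y t ≤ countLE x t :=
  Finset.card_le_card (Finset.monotone_filter_right _ fun i _ hi => (h i).trans hi)

lemma countLE_update_eq {m : ℕ} (x : Fin m → ℝ) (i : Fin m) {s s' t : ℝ} (hs : s ≤ t)
    (hs' : s' ≤ t) :
    countLE (Function.update x i s) t = countLE (Function.update x i s') t := by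
  unfold countLE
  congr 1
  ext j
  rcases eq_or_ne j i with rfl | hj <;> simp [*]

lemma ecdfTail_update_eq {m : ℕ} (x : Fin m → ℝ) (i : Fin m) {s s' lam : ℝ} (hs : s ≤ lam)
    (hs' : s' ≤ lam) :
    ecdfTail lam (Function.update x i s) = ecdfTail lam (Function.update x i s') := by
  ext ⟨t, ht⟩
  simp only [ecdfTail, ecdf]
  rw [countLE_update_eq x i (hs.trans ht) (hs'.trans ht)]

lemma measurable_countLE {m : ℕ} (t : ℝ) : Measurable fun x : Fin m → ℝ => countLE x t := by
  simp only [countLE, Finset.card_filter]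
  refine Finset.measurable_sum _ fun i _ => Measurable.ite ?_ measurable_const measurable_const
  exact measurableSet_le (measurable_pi_apply i) measurable_const

lemma measurable_countLE_comp {m : ℕ} {c : (Fin m → ℝ) → ℝ} (hc : Measurable c) :
    Measurable fun x : Fin m → ℝ => countLE x (c x) := by
  simp only [countLE, Finset.card_filter]
  refine Finset.measurable_sum _ fun i _ => Measurable.ite ?_ measurable_const measurable_const
  exact measurableSet_le (measurable_pi_apply i) hc

lemma measurable_ecdfTail {m : ℕ} (lam : ℝ) :
    Measurable fun x : Fin m → ℝ => ecdfTail lam x := by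
  refine measurable_pi_lambda _ fun t => ?_
  exact (measurable_from_nat.comp (measurable_countLE (t : ℝ))).div_const _

/-- The `i`-th order statistic is at most `t` iff at least `i` entries are at most `t`. -/
lemma orderStat_le_iff {m : ℕ} (x : Fin m → ℝ) {i : ℕ} (hi : 1 ≤ i) (him : i ≤ m) (t : ℝ) :
    orderStat x i ≤ t ↔ i ≤ countLE x t := by
  have h1 := Tuple.lt_card_le_iff_apply_le_of_monotone (f := x ∘ Tuple.sort x) (a := t)
    (j := ⟨i - 1, by omega⟩) (Tuple.monotone_sort x)
  have h2 : (Finset.univ.filter fun j => (x ∘ Tuple.sort x) j ≤ t).card = countLE x t := by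
    refine Finset.card_bij (fun j _ => Tuple.sort x j) ?_ ?_ ?_
    · intro j hj
      simpa using hj
    · intro j _ k _ h
      exact (Tuple.sort x).injective h
    · intro j hj
      exact ⟨(Tuple.sort x).symm j, by simpa using hj, by simp⟩
  rw [h2] at h1
  simp only [orderStat, dif_pos (And.intro hi him)]
  rw [← Function.comp_apply (f := x), ← h1]
  simp only
  omega

/-- Replaces sorting by counting, which is monotone in the data and easy to measure. Index 0 needs
no check, being the default value of `Nat.findGreatest`. -/
lemma stepUpR_eq {m : ℕ} (x : Fin m → ℝ) (c : ℕ → ℝ) :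
    stepUpR x c = Nat.findGreatest (fun i => i ≤ countLE x (c i)) m := by
  refine le_antisymm ?_ ?_
  · rcases Nat.eq_zero_or_pos (stepUpR x c) with h | h
    · simp [h]
    · have hm : stepUpR x c ≤ m := Nat.findGreatest_le m
      refine Nat.le_findGreatest hm ((orderStat_le_iff x h hm _).1 ?_)
      exact Nat.findGreatest_of_ne_zero (P := fun i => orderStat x i ≤ c i) rfl h.ne'
  · set r := Nat.findGreatest (fun i => i ≤ countLE x (c i)) m with hr
    rcases Nat.eq_zero_or_pos r with h | h
    · simp [h]
    · have hm : r ≤ m := Nat.findGreatest_le m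
      refine Nat.le_findGreatest hm ((orderStat_le_iff x h hm _).2 ?_)
      exact Nat.findGreatest_of_ne_zero (P := fun i => i ≤ countLE x (c i)) hr.symm h.ne'

lemma stepUpR_le_countLE {m : ℕ} (x : Fin m → ℝ) (c : ℕ → ℝ) :
    stepUpR x c ≤ countLE x (c (stepUpR x c)) := by
  rcases Nat.eq_zero_or_pos (stepUpR x c) with h | h
  · simp [h]
  · exact Nat.findGreatest_of_ne_zero (P := fun i => i ≤ countLE x (c i)) (stepUpR_eq x c).symm h.ne'

lemma le_stepUpR {m : ℕ} {x : Fin m → ℝ} {c : ℕ → ℝ} {k : ℕ} (h : k ≤ countLE x (c k)) :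
    k ≤ stepUpR x c := by
  rw [stepUpR_eq]
  exact Nat.le_findGreatest (h.trans (countLE_le _ _)) h

/-- If more than `R` p-values lay below the threshold at `R`, then `R + 1` would also qualify, since
its critical value is no smaller; this contradicts maximality. -/
lemma countLE_critVal_stepUpR {m : ℕ} (x : Fin m → ℝ) {c : ℕ → ℝ} (hc : Monotone c) :
    countLE x (c (stepUpR x c)) = stepUpR x c := by
  refine le_antisymm ?_ (stepUpR_le_countLE x c)
  by_contra! h
  have := le_stepUpR (x := x) (c := c) (k := stepUpR x c + 1)
    (Nat.le_trans h (countLE_mono x (hc (Nat.le_succ _))))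
  omega

lemma stepUpV_le_stepUpR {m : ℕ} (I0 : Finset (Fin m)) (x : Fin m → ℝ) {c : ℕ → ℝ}
    (hc : Monotone c) : stepUpV I0 x c ≤ stepUpR x c := by
  conv_rhs => rw [← countLE_critVal_stepUpR x hc]
  exact Finset.card_le_card (Finset.filter_subset_filter _ (Finset.subset_univ _))

lemma stepUpR_anti {m : ℕ} {x y : Fin m → ℝ} (h : x ≤ y) (c : ℕ → ℝ) :
    stepUpR y c ≤ stepUpR x c :=
  le_stepUpR ((stepUpR_le_countLE y c).trans (countLE_anti h _))

lemma critVal_mono {α lam M : ℝ} (hα : 0 < α) (hM : 0 < M) : Monotone (critVal α lam M) := by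
  intro i j h
  unfold critVal
  gcongr

/-! ### Adaptive tests: measurability and changes of one coordinate -/

/-- Estimators of the number of true nulls that satisfy the bounds of the adaptive test at every
vector of p-values. -/
structure IsAdmissible (α lam K : ℝ) (m : ℕ) (g : (Set.Ici lam → ℝ) → ℝ) : Prop where
  measurable : Measurable g
  pos : ∀ x : Fin m → ℝ, 0 < g (ecdfTail lam x)
  lower : ∀ x : Fin m → ℝ, (countLE x lam : ℝ) ≤ lam / α * g (ecdfTail lam x)
  upper : ∀ x : Fin m → ℝ, g (ecdfTail lam x) ≤ K * m

section Admissible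

variable {α lam K : ℝ} {m : ℕ} {g : (Set.Ici lam → ℝ) → ℝ}

lemma IsAdmissible.monotone_crit (hg : IsAdmissible α lam K m g) (hα : 0 < α)
    (x : Fin m → ℝ) : Monotone (adaptiveCrit α lam g x) :=
  critVal_mono hα (hg.pos x)

lemma IsAdmissible.numFalseRej_le (hg : IsAdmissible α lam K m g) (hα : 0 < α)
    (I0 : Finset (Fin m)) (x : Fin m → ℝ) :
    numFalseRej α lam g I0 x ≤ numRej α lam g x :=
  stepUpV_le_stepUpR I0 x (hg.monotone_crit hα x)

lemma fdp_nonneg (I0 : Finset (Fin m)) (x : Fin m → ℝ) : 0 ≤ fdp α lam g I0 x := by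
  unfold fdp; positivity

lemma IsAdmissible.fdp_le_one (hg : IsAdmissible α lam K m g) (hα : 0 < α)
    (I0 : Finset (Fin m)) (x : Fin m → ℝ) : fdp α lam g I0 x ≤ 1 :=
  div_le_one_of_le₀ (by exact_mod_cast hg.numFalseRej_le hα I0 x) (by positivity)

lemma IsAdmissible.measurable_crit (hg : IsAdmissible α lam K m g) (i : ℕ) :
    Measurable fun x : Fin m → ℝ => adaptiveCrit α lam g x i :=
  (((hg.measurable.comp (measurable_ecdfTail lam)).const_div _).mul_const _).min measurable_const

lemma IsAdmissible.measurable_numRej (hg : IsAdmissible α lam K m g) :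
    Measurable fun x : Fin m → ℝ => numRej α lam g x := by
  simp only [numRej, stepUpR_eq]
  exact measurable_findGreatest fun k _ =>
    measurableSet_le measurable_const (measurable_countLE_comp (hg.measurable_crit k))

lemma IsAdmissible.measurable_crit_numRej (hg : IsAdmissible α lam K m g) :
    Measurable fun x : Fin m → ℝ => adaptiveCrit α lam g x (numRej α lam g x) := by
  have h := (((measurable_from_nat (f := fun k : ℕ => (k : ℝ))).comp hg.measurable_numRej).div
    (hg.measurable.comp (measurable_ecdfTail (m := m) lam))).mul_const α
  exact h.min (measurable_const (a := lam))

lemma IsAdmissible.measurable_numFalseRej (hg : IsAdmissible α lam K m g) (I0 : Finset (Fin m)) :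
    Measurable fun x : Fin m → ℝ => numFalseRej α lam g I0 x := by
  simp only [numFalseRej, stepUpV, Finset.card_filter]
  refine Finset.measurable_sum _ fun i _ => Measurable.ite ?_ measurable_const measurable_const
  exact measurableSet_le (measurable_pi_apply i) hg.measurable_crit_numRej

lemma IsAdmissible.measurable_fdp (hg : IsAdmissible α lam K m g) (I0 : Finset (Fin m)) :
    Measurable fun x : Fin m → ℝ => fdp α lam g I0 x :=
  (measurable_from_nat.comp (hg.measurable_numFalseRej I0)).div
    (measurable_from_nat.comp hg.measurable_numRej)

lemma adaptiveCrit_le (x : Fin m → ℝ) (i : ℕ) : adaptiveCrit α lam g x i ≤ lam :=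
  min_le_right _ _

/-- At the number of rejections the truncation of the critical values at `lam` is not active. -/
lemma IsAdmissible.crit_numRej (hg : IsAdmissible α lam K m g) (hα : 0 < α) (x : Fin m → ℝ) :
    adaptiveCrit α lam g x (numRej α lam g x) =
      (numRej α lam g x : ℝ) / g (ecdfTail lam x) * α := by
  refine min_eq_left ?_
  have h1 : numRej α lam g x ≤ countLE x lam :=
    (stepUpR_le_countLE x _).trans (countLE_mono x (adaptiveCrit_le x _))
  have h2 : (numRej α lam g x : ℝ) ≤ lam / α * g (ecdfTail lam x) :=
    le_trans (by exact_mod_cast h1) (hg.lower x)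
  have h3 := hg.pos x
  rw [div_mul_eq_mul_div, div_le_iff₀ h3]
  calc (numRej α lam g x : ℝ) * α ≤ lam / α * g (ecdfTail lam x) * α := by gcongr
    _ = lam * g (ecdfTail lam x) := by field_simp

lemma adaptiveCrit_update_eq (x : Fin m → ℝ) (i : Fin m) {s s' : ℝ} (hs : s ≤ lam)
    (hs' : s' ≤ lam) : adaptiveCrit α lam g (Function.update x i s) =
      adaptiveCrit α lam g (Function.update x i s') := by
  unfold adaptiveCrit
  rw [ecdfTail_update_eq x i hs hs']

/-- Both vectors have the same critical values because the change happens below `lam`, so the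
monotonicity for fixed critical values applies. -/
lemma numRej_update_anti (x : Fin m → ℝ) (i : Fin m) {s s' : ℝ} (h : s ≤ s') (hs' : s' ≤ lam) :
    numRej α lam g (Function.update x i s') ≤ numRej α lam g (Function.update x i s) := by
  unfold numRej
  rw [adaptiveCrit_update_eq x i hs' (h.trans hs')]
  exact stepUpR_anti (update_le_update_iff.2 ⟨h, fun _ _ => le_rfl⟩) _

/-- Lowering a rejected p-value does not change the number of rejections. -/
lemma numRej_update_eq (x : Fin m → ℝ) (i : Fin m) {s t : ℝ} (hst : s ≤ t)
    (ht : t ≤ adaptiveCrit α lam g (Function.update x i s)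
      (numRej α lam g (Function.update x i s))) :
    numRej α lam g (Function.update x i t) = numRej α lam g (Function.update x i s) := by
  have htl : t ≤ lam := ht.trans (adaptiveCrit_le _ _)
  refine le_antisymm (numRej_update_anti x i hst htl) ?_
  refine le_stepUpR ?_
  rw [adaptiveCrit_update_eq x i htl (hst.trans htl), countLE_update_eq x i ht (hst.trans ht)]
  exact stepUpR_le_countLE _ _

/-- A zero p-value lies below every critical value. This excludes `R = 0`, so that `R⁻¹ * R = 1` in
the bound for the contribution of one null. -/
lemma IsAdmissible.one_le_numRej_update_zero (hg : IsAdmissible α lam K m g) (hα : 0 < α)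
    (hlam : 0 ≤ lam) (x : Fin m → ℝ) (i : Fin m) :
    1 ≤ numRej α lam g (Function.update x i 0) := by
  have h := (hg.pos (Function.update x i 0)).le
  refine le_stepUpR (Finset.card_pos.2 ⟨i, Finset.mem_filter.2 ⟨Finset.mem_univ _, ?_⟩⟩)
  rw [Function.update_self]
  exact le_min (by positivity) hlam

lemma fdp_eq_sum (I0 : Finset (Fin m)) (x : Fin m → ℝ) :
    fdp α lam g I0 x = ∑ i ∈ I0,
      if x i ≤ adaptiveCrit α lam g x (numRej α lam g x) then (numRej α lam g x : ℝ)⁻¹ else 0 := by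
  rw [← Finset.sum_filter, Finset.sum_const, nsmul_eq_mul]
  rfl

end Admissible

end AdaptiveStepUp
namespace AdaptiveStepUp

open scoped ENNReal

/-! ### Resampling one true null: lower bound for the false discovery rate -/

/-- Under `μ`, the `i`-th coordinate is uniform on `[0, 1]` and independent of the others: it can be
resampled. -/
def IsUniformCoord {m : ℕ} (μ : Measure (Fin m → ℝ)) (i : Fin m) : Prop :=
  ∀ f : (Fin m → ℝ) → ℝ≥0∞, Measurable f →
    ∫⁻ x, f x ∂μ = ∫⁻ x, (∫⁻ t in Set.Icc (0 : ℝ) 1, f (Function.update x i t)) ∂μ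

section Law

variable {α lam K : ℝ} {m : ℕ} {g : (Set.Ici lam → ℝ) → ℝ} {μ : Measure (Fin m → ℝ)}
  {I0 : Finset (Fin m)}

/-- The contribution of one true null to the false discovery rate. -/
lemma IsAdmissible.le_lintegral_term [IsProbabilityMeasure μ] (hg : IsAdmissible α lam K m g)
    (hα : 0 < α) (hlam : 0 ≤ lam) (hlam1 : lam < 1) {i : Fin m} (hi : IsUniformCoord μ i) :
    ENNReal.ofReal (α / (K * m)) ≤ ∫⁻ x, ENNReal.ofReal
      (if x i ≤ adaptiveCrit α lam g x (numRej α lam g x) then (numRej α lam g x : ℝ)⁻¹ else 0)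
        ∂μ := by
  have hmeas : Measurable fun x : Fin m → ℝ => ENNReal.ofReal
      (if x i ≤ adaptiveCrit α lam g x (numRej α lam g x) then (numRej α lam g x : ℝ)⁻¹ else 0) :=
    (Measurable.ite (measurableSet_le (measurable_pi_apply i) hg.measurable_crit_numRej)
      (measurable_from_nat.comp hg.measurable_numRej).inv measurable_const).ennreal_ofReal
  rw [hi _ hmeas]
  have key : ∀ x : Fin m → ℝ, ENNReal.ofReal (α / (K * m)) ≤
      ∫⁻ t in Set.Icc (0 : ℝ) 1, ENNReal.ofReal
        (if Function.update x i t i ≤ adaptiveCrit α lam g (Function.update x i t)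
          (numRej α lam g (Function.update x i t))
          then (numRej α lam g (Function.update x i t) : ℝ)⁻¹ else 0) := by
    intro x
    set y := Function.update x i 0 with hy
    set b := adaptiveCrit α lam g y (numRej α lam g y) with hb
    have hR : (1 : ℝ) ≤ numRej α lam g y := by
      exact_mod_cast hg.one_le_numRej_update_zero hα hlam x i
    have hbl : b ≤ lam := adaptiveCrit_le _ _
    have hM := hg.pos y
    have hbM : b = (numRej α lam g y : ℝ) / g (ecdfTail lam y) * α := hg.crit_numRej hα y
    have hint : ENNReal.ofReal (α / (K * m)) ≤
        ∫⁻ _ in Set.Icc (0 : ℝ) b, ENNReal.ofReal (numRej α lam g y : ℝ)⁻¹ := by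
      -- On `[0, b]` the integrand is the constant `R⁻¹` and `b = R α / m̂₀`, so `R` cancels.
      rw [setLIntegral_const, Real.volume_Icc, sub_zero, ← ENNReal.ofReal_mul (by positivity)]
      refine ENNReal.ofReal_le_ofReal ?_
      have : (numRej α lam g y : ℝ)⁻¹ * b = α / g (ecdfTail lam y) := by
        rw [hbM]; field_simp
      rw [this]
      exact div_le_div_of_nonneg_left hα.le hM (hg.upper y)
    refine hint.trans ((setLIntegral_mono' measurableSet_Icc ?_).trans
      (lintegral_mono_set (Set.Icc_subset_Icc_right (hbl.trans hlam1.le))))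
    intro t ht
    have h1 : numRej α lam g (Function.update x i t) = numRej α lam g y :=
      numRej_update_eq x i ht.1 ht.2
    have h2 : adaptiveCrit α lam g (Function.update x i t) = adaptiveCrit α lam g y :=
      adaptiveCrit_update_eq x i (ht.2.trans hbl) hlam
    rw [h1, h2, Function.update_self, if_pos ht.2]
  calc ENNReal.ofReal (α / (K * m)) = ∫⁻ _, ENNReal.ofReal (α / (K * m)) ∂μ := by simp
    _ ≤ _ := lintegral_mono key

/-- A lower bound for the false discovery rate. -/
lemma IsAdmissible.le_integral_fdp [IsProbabilityMeasure μ] (hg : IsAdmissible α lam K m g)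
    (hα : 0 < α) (hlam : 0 ≤ lam) (hlam1 : lam < 1) (hI0 : ∀ i ∈ I0, IsUniformCoord μ i) :
    I0.card * (α / (K * m)) ≤ ∫ x, fdp α lam g I0 x ∂μ := by
  have h0 : ∀ x : Fin m → ℝ, 0 ≤ fdp α lam g I0 x := fdp_nonneg I0
  have hint : Integrable (fun x : Fin m → ℝ => fdp α lam g I0 x) μ :=
    Integrable.of_bound (hg.measurable_fdp I0).aestronglyMeasurable 1 (ae_of_all _ fun x => by
      rw [Real.norm_of_nonneg (h0 x)]; exact hg.fdp_le_one hα I0 x)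
  rw [← ENNReal.ofReal_le_ofReal_iff (integral_nonneg h0),
    ofReal_integral_eq_lintegral_ofReal hint (ae_of_all _ h0)]
  have hsum : ∀ x : Fin m → ℝ, ENNReal.ofReal (fdp α lam g I0 x) = ∑ i ∈ I0, ENNReal.ofReal
      (if x i ≤ adaptiveCrit α lam g x (numRej α lam g x) then (numRej α lam g x : ℝ)⁻¹
        else 0) := fun x => by
    rw [fdp_eq_sum, ENNReal.ofReal_sum_of_nonneg]
    intro i _
    split_ifs <;> positivity
  simp_rw [hsum]
  rw [lintegral_finsetSum' _ fun i _ => Measurable.aemeasurable ?_]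
  · rw [ENNReal.ofReal_mul (by positivity), ENNReal.ofReal_natCast, ← nsmul_eq_mul]
    exact Finset.card_nsmul_le_sum _ _ _ fun i hi =>
      hg.le_lintegral_term hα hlam hlam1 (hI0 i hi)
  · exact (Measurable.ite (measurableSet_le (measurable_pi_apply i) hg.measurable_crit_numRej)
      (measurable_from_nat.comp hg.measurable_numRej).inv measurable_const).ennreal_ofReal

/-! ### Few rejections compared with no false rejections -/

/-- The p-value vectors with at most `C` rejections and at least `n` p-values below `lam`, for which
the p-values in `S` exceed `a`. -/
def fewRejSet (α lam : ℝ) (g : (Set.Ici lam → ℝ) → ℝ) (C n a : ℝ) (S : Finset (Fin m)) :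
    Set (Fin m → ℝ) :=
  {x | (numRej α lam g x : ℝ) ≤ C ∧ n ≤ countLE x lam ∧ ∀ j ∈ S, a < x j}

lemma IsAdmissible.measurableSet_fewRejSet (hg : IsAdmissible α lam K m g) (C n a : ℝ)
    (S : Finset (Fin m)) : MeasurableSet (fewRejSet α lam g C n a S) := by
  have h1 : Measurable fun x : Fin m → ℝ => (numRej α lam g x : ℝ) :=
    measurable_from_nat.comp hg.measurable_numRej
  have h2 : Measurable fun x : Fin m → ℝ => (countLE x lam : ℝ) :=
    measurable_from_nat.comp (measurable_countLE lam)
  refine (measurableSet_le h1 measurable_const).inter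
    ((measurableSet_le measurable_const h2).inter ?_)
  have : {x : Fin m → ℝ | ∀ j ∈ S, a < x j} = ⋂ j ∈ S, {x | a < x j} := by
    ext; simp
  change MeasurableSet {x : Fin m → ℝ | ∀ j ∈ S, a < x j}
  rw [this]
  exact S.measurableSet_biInter fun j _ => measurableSet_lt measurable_const (measurable_pi_apply j)

/-- Raising a p-value within `[0, lam]` can only lower `R` and leaves the count at `lam` unchanged.
-/
lemma update_mem_fewRejSet {C n a s t : ℝ} {S : Finset (Fin m)} {x : Fin m → ℝ} {i : Fin m}
    (hs : s ≤ a) (hat : a < t) (ht : t ≤ lam)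
    (h : Function.update x i s ∈ fewRejSet α lam g C n a S) :
    Function.update x i t ∈ fewRejSet α lam g C n a (insert i S) := by
  obtain ⟨h1, h2, h3⟩ := h
  have hst : s ≤ t := hs.trans hat.le
  refine ⟨le_trans (by exact_mod_cast numRej_update_anti x i hst ht) h1, ?_, ?_⟩
  · rwa [countLE_update_eq x i ht (hst.trans ht)]
  · intro j hj
    rcases eq_or_ne j i with rfl | hji
    · simpa using hat
    · have := h3 j (Finset.mem_of_mem_insert_of_ne hj hji)
      simpa [hji] using this

/-- Moving one p-value out of `[0, a]` costs only a factor close to one. -/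
lemma IsAdmissible.measure_fewRejSet_le_insert (hg : IsAdmissible α lam K m g) {C n a : ℝ}
    (ha : 0 ≤ a) (hal : a < lam) (hlam1 : lam < 1) {i : Fin m} (hi : IsUniformCoord μ i)
    (S : Finset (Fin m)) :
    μ (fewRejSet α lam g C n a S) ≤
      (1 + ENNReal.ofReal (a / (lam - a))) * μ (fewRejSet α lam g C n a (insert i S)) := by
  set A := fewRejSet α lam g C n a S with hA
  set B := fewRejSet α lam g C n a (insert i S) with hB
  have hAm : MeasurableSet A := hg.measurableSet_fewRejSet C n a S
  have hBm : MeasurableSet B := hg.measurableSet_fewRejSet C n a (insert i S)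
  have hlow : MeasurableSet {x : Fin m → ℝ | x i ≤ a} :=
    measurableSet_le (measurable_pi_apply i) measurable_const
  have hsub : A ⊆ B ∪ (A ∩ {x | x i ≤ a}) := by
    intro x hx
    by_cases hxa : x i ≤ a
    · exact Or.inr ⟨hx, hxa⟩
    · refine Or.inl ⟨hx.1, hx.2.1, fun j hj => ?_⟩
      rcases Finset.mem_insert.1 hj with rfl | hj
      · exact not_le.1 hxa
      · exact hx.2.2 j hj
  have hfib : ∀ x : Fin m → ℝ,
      ∫⁻ t in Set.Icc (0 : ℝ) 1, (A ∩ {x | x i ≤ a}).indicator 1 (Function.update x i t) ≤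
      ENNReal.ofReal (a / (lam - a)) *
        ∫⁻ t in Set.Icc (0 : ℝ) 1, B.indicator (1 : (Fin m → ℝ) → ℝ≥0∞) (Function.update x i t) := by
    intro x
    -- On each fibre, one point of `A` with coordinate in `[0, a]` puts all of `(a, lam]` into `B`:
    -- mass at most `a` is compared with mass at least `lam - a`. Without such a point the left side
    -- vanishes.
    by_cases hex : ∃ s ∈ Set.Icc (0 : ℝ) a, Function.update x i s ∈ A
    · obtain ⟨s, hs, hsA⟩ := hex
      have h1 : ∫⁻ t in Set.Icc (0 : ℝ) 1,
          (A ∩ {x | x i ≤ a}).indicator 1 (Function.update x i t) ≤ ENNReal.ofReal a := by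
        calc _ ≤ ∫⁻ t in Set.Icc (0 : ℝ) 1, (Set.Iic a).indicator (1 : ℝ → ℝ≥0∞) t := by
              refine lintegral_mono fun t => ?_
              by_cases h : Function.update x i t ∈ A ∩ {x | x i ≤ a}
              · have : t ∈ Set.Iic a := by simpa using h.2
                simp [h, this]
              · simp [h]
          _ = volume (Set.Iic a ∩ Set.Icc 0 1) := by
              rw [lintegral_indicator_one measurableSet_Iic,
                Measure.restrict_apply measurableSet_Iic]
          _ ≤ volume (Set.Icc 0 a) := measure_mono fun t ht => ⟨ht.2.1, ht.1⟩
          _ = ENNReal.ofReal a := by simp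
      have h2 : ENNReal.ofReal (lam - a) ≤
          ∫⁻ t in Set.Icc (0 : ℝ) 1, B.indicator (1 : (Fin m → ℝ) → ℝ≥0∞) (Function.update x i t) := by
        calc ENNReal.ofReal (lam - a) = ∫⁻ _ in Set.Ioc a lam, 1 := by simp
          _ ≤ ∫⁻ t in Set.Ioc a lam,
              B.indicator (1 : (Fin m → ℝ) → ℝ≥0∞) (Function.update x i t) := by
            refine setLIntegral_mono' measurableSet_Ioc fun t ht => ?_
            have : Function.update x i t ∈ B := update_mem_fewRejSet hs.2 ht.1 ht.2 hsA
            simp [this]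
          _ ≤ _ := lintegral_mono_set (Set.Ioc_subset_Icc_self.trans
              (Set.Icc_subset_Icc ha hlam1.le))
      refine h1.trans (le_trans (le_of_eq ?_) (mul_le_mul_right h2 _))
      have : 0 < lam - a := sub_pos.2 hal
      rw [← ENNReal.ofReal_mul (by positivity), div_mul_cancel₀ _ this.ne']
    · refine le_trans (le_of_eq ?_) zero_le
      refine setLIntegral_eq_zero measurableSet_Icc fun t ht => ?_
      refine Set.indicator_of_notMem (fun h => hex ⟨t, ⟨ht.1, ?_⟩, h.1⟩) _
      simpa using h.2
  have hlowA : μ (A ∩ {x | x i ≤ a}) ≤ ENNReal.ofReal (a / (lam - a)) * μ B := by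
    rw [← lintegral_indicator_one (hAm.inter hlow), ← lintegral_indicator_one hBm,
      hi _ (measurable_one.indicator (hAm.inter hlow)), hi _ (measurable_one.indicator hBm),
      ← lintegral_const_mul' _ _ ENNReal.ofReal_ne_top]
    exact lintegral_mono hfib
  calc μ A ≤ μ B + μ (A ∩ {x | x i ≤ a}) := (measure_mono hsub).trans (measure_union_le _ _)
    _ ≤ μ B + ENNReal.ofReal (a / (lam - a)) * μ B := by gcongr
    _ = _ := by ring

lemma IsAdmissible.measure_fewRejSet_le (hg : IsAdmissible α lam K m g) {C n a : ℝ}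
    (ha : 0 ≤ a) (hal : a < lam) (hlam1 : lam < 1) (S : Finset (Fin m))
    (hS : ∀ i ∈ S, IsUniformCoord μ i) :
    μ (fewRejSet α lam g C n a ∅) ≤
      (1 + ENNReal.ofReal (a / (lam - a))) ^ S.card * μ (fewRejSet α lam g C n a S) := by
  classical
  induction S using Finset.induction_on with
  | empty => simp
  | insert i S hiS ih =>
    refine (ih fun j hj => hS j (Finset.mem_insert_of_mem hj)).trans ?_
    rw [Finset.card_insert_of_notMem hiS, pow_succ, mul_assoc]
    exact mul_le_mul_right (hg.measure_fewRejSet_le_insert ha hal hlam1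
      (hS i (Finset.mem_insert_self i S)) S) _

/-- The threshold is `R α / m̂₀`, with `R ≤ C` and `α / m̂₀ ≤ lam / n`, so it is at most the level
that every null p-value exceeds. -/
lemma IsAdmissible.fewRejSet_subset (hg : IsAdmissible α lam K m g) (hα : 0 < α)
    (hlam : 0 < lam) {C n : ℝ} (hn : 0 < n) :
    fewRejSet α lam g C n (C * lam / n) I0 ⊆ {x | numFalseRej α lam g I0 x = 0} := by
  rintro x ⟨h1, h2, h3⟩
  refine Finset.card_eq_zero.2 (Finset.filter_eq_empty_iff.2 fun i hi => not_le.2 ?_)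
  refine lt_of_le_of_lt ?_ (h3 i hi)
  change adaptiveCrit α lam g x (numRej α lam g x) ≤ _
  rw [hg.crit_numRej hα]
  have hM := hg.pos x
  have h4 : n ≤ lam / α * g (ecdfTail lam x) := h2.trans (hg.lower x)
  have hC : 0 ≤ C := (Nat.cast_nonneg _).trans h1
  rw [div_mul_eq_mul_div, div_le_div_iff₀ hM hn]
  calc (numRej α lam g x : ℝ) * α * n ≤ C * α * (lam / α * g (ecdfTail lam x)) := by gcongr
    _ = C * lam * g (ecdfTail lam x) := by field_simp

/-- Few rejections are, up to a bounded factor, as rare as no false rejections. -/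
lemma IsAdmissible.measure_numRej_le (hg : IsAdmissible α lam K m g) (hα : 0 < α)
    (hlam1 : lam < 1) {C n : ℝ} (hC : 0 ≤ C) (hn : 0 < n) (hCn : 2 * C ≤ n) (hlam : 0 < lam)
    (hI0 : ∀ i ∈ I0, IsUniformCoord μ i) :
    μ {x | (numRej α lam g x : ℝ) ≤ C} ≤
      ENNReal.ofReal (Real.exp (I0.card * (2 * C / n))) * μ {x | numFalseRej α lam g I0 x = 0} +
        μ {x | (countLE x lam : ℝ) < n} := by
  have ha : 0 ≤ C * lam / n := by positivity
  -- The assumption `2 * C ≤ n` keeps `lam - a ≥ lam / 2`, so the cost per null is at most `1 + 2 *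
  -- C / n`.
  have hal : C * lam / n ≤ lam / 2 := by
    rw [div_le_div_iff₀ hn two_pos]
    nlinarith
  have hsub : {x : Fin m → ℝ | (numRej α lam g x : ℝ) ≤ C} ⊆
      fewRejSet α lam g C n (C * lam / n) ∅ ∪ {x | (countLE x lam : ℝ) < n} := by
    intro x hx
    rcases lt_or_ge (countLE x lam : ℝ) n with h | h
    · exact Or.inr h
    · exact Or.inl ⟨hx, h, by simp⟩
  refine (measure_mono hsub).trans ((measure_union_le _ _).trans ?_)
  gcongr
  refine (hg.measure_fewRejSet_le ha (by linarith) hlam1 I0 hI0).trans ?_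
  refine mul_le_mul' ?_ (measure_mono (hg.fewRejSet_subset hα hlam hn))
  have h1 : C * lam / n / (lam - C * lam / n) ≤ 2 * C / n := by
    calc C * lam / n / (lam - C * lam / n) ≤ C * lam / n / (lam / 2) := by
          gcongr; linarith
      _ = 2 * C / n := by field_simp
  have h2 : 0 ≤ C * lam / n / (lam - C * lam / n) := div_nonneg ha (by linarith)
  rw [← ENNReal.ofReal_one, ← ENNReal.ofReal_add zero_le_one h2,
    ← ENNReal.ofReal_pow (by positivity)]
  refine ENNReal.ofReal_le_ofReal ?_
  rw [Real.exp_nat_mul]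
  refine pow_le_pow_left₀ (by positivity) ?_ _
  calc 1 + C * lam / n / (lam - C * lam / n) ≤ 2 * C / n + 1 := by linarith
    _ ≤ _ := Real.add_one_le_exp _

end Law

end AdaptiveStepUp
namespace AdaptiveStepUp

open scoped ENNReal

/-! ### From the basic independence model to resampling -/

section Independence

variable {Ω : Type*} [MeasurableSpace Ω] {P : Measure Ω}

/-- The hypotheses make the law of the triple a product of three laws, which can be reassociated. -/
lemma IndepFun.prodMk_of_indepFun_prodMk {β γ δ : Type*} [MeasurableSpace β] [MeasurableSpace γ]
    [MeasurableSpace δ] [IsProbabilityMeasure P] {X : Ω → β} {Y : Ω → γ} {Z : Ω → δ}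
    (hX : Measurable X) (hY : Measurable Y) (hZ : Measurable Z) (hXY : IndepFun X Y P)
    (hXYZ : IndepFun (fun ω => (X ω, Y ω)) Z P) : IndepFun X (fun ω => (Y ω, Z ω)) P := by
  have := Measure.isProbabilityMeasure_map (μ := P) hX.aemeasurable
  have := Measure.isProbabilityMeasure_map (μ := P) hY.aemeasurable
  have := Measure.isProbabilityMeasure_map (μ := P) hZ.aemeasurable
  have hYZ : IndepFun Y Z P := hXYZ.comp measurable_snd measurable_id
  rw [indepFun_iff_map_prod_eq_prod_map_map hX.aemeasurable (hY.prodMk hZ).aemeasurable,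
    (indepFun_iff_map_prod_eq_prod_map_map hY.aemeasurable hZ.aemeasurable).1 hYZ,
    ← Measure.prodAssoc_prod,
    ← (indepFun_iff_map_prod_eq_prod_map_map hX.aemeasurable hY.aemeasurable).1 hXY,
    ← (indepFun_iff_map_prod_eq_prod_map_map (hX.prodMk hY).aemeasurable hZ.aemeasurable).1 hXYZ,
    Measure.map_map MeasurableEquiv.prodAssoc.measurable ((hX.prodMk hY).prodMk hZ)]
  rfl

variable {m : ℕ} {I0 : Finset (Fin m)} {p : Fin m → Ω → ℝ}

lemma IsBI.measurable_vec (h : IsBI P I0 p) : Measurable fun ω i => p i ω :=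
  measurable_pi_lambda _ h.measurable

lemma IsBI.map_eq [IsProbabilityMeasure P] (h : IsBI P I0 p) {i : Fin m} (hi : i ∈ I0) :
    P.map (p i) = volume.restrict (Set.Icc (0 : ℝ) 1) := by
  have := Measure.isProbabilityMeasure_map (μ := P) (h.measurable i).aemeasurable
  refine Measure.ext_of_Iic _ _ fun t => ?_
  rw [Measure.map_apply (h.measurable i) measurableSet_Iic,
    Measure.restrict_apply measurableSet_Iic]
  change P {ω | p i ω ≤ t} = _
  rcases lt_or_ge t 0 with ht | ht
  · have h1 : {ω | p i ω ≤ t} = ∅ := by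
      ext ω
      simpa using ht.trans_le (h.mem_Icc i ω).1
    have h2 : Set.Iic t ∩ Set.Icc (0 : ℝ) 1 = ∅ := by
      ext s
      simp only [Set.mem_inter_iff, Set.mem_Iic, Set.mem_Icc, Set.mem_empty_iff_false, iff_false]
      intro hs
      linarith [hs.2.1]
    rw [h1, h2]; simp
  rcases le_or_gt t 1 with ht1 | ht1
  · rw [h.unif_null i hi t ⟨ht, ht1⟩]
    have h2 : Set.Iic t ∩ Set.Icc (0 : ℝ) 1 = Set.Icc 0 t := by
      ext s
      simp only [Set.mem_inter_iff, Set.mem_Iic, Set.mem_Icc]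
      constructor
      · exact fun hs => ⟨hs.2.1, hs.1⟩
      · exact fun hs => ⟨hs.2, hs.1, hs.2.trans ht1⟩
    rw [h2]; simp
  · have h1 : {ω | p i ω ≤ t} = Set.univ := by
      ext ω
      simpa using (h.mem_Icc i ω).2.trans ht1.le
    have h2 : Set.Iic t ∩ Set.Icc (0 : ℝ) 1 = Set.Icc 0 1 :=
      Set.inter_eq_right.2 fun s hs => hs.2.trans ht1.le
    rw [h1, h2]; simp

/-- Each p-value of a true null is independent of all the other p-values. -/
lemma IsBI.indepFun_others [IsProbabilityMeasure P] (h : IsBI P I0 p) {i : Fin m} (hi : i ∈ I0) :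
    IndepFun (p i) (fun ω (j : {j // j ≠ i}) => p j ω) P := by
  classical
  let S : Finset {j // j ∈ I0} := {⟨i, hi⟩}
  have hS : IndepFun (fun ω (j : S) => p j ω) (fun ω (j : (Sᶜ : Finset {j // j ∈ I0})) => p j ω) P :=
    h.indep_null.indepFun_finset S Sᶜ disjoint_compl_right fun j => h.measurable j
  have hX : Measurable (p i) := h.measurable i
  have hY : Measurable fun ω (j : (Sᶜ : Finset {j // j ∈ I0})) => p j ω :=
    measurable_pi_lambda _ fun j => h.measurable j
  have hZ : Measurable fun ω (j : {j // j ∉ I0}) => p j ω :=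
    measurable_pi_lambda _ fun j => h.measurable j
  have hXY : IndepFun (p i) (fun ω (j : (Sᶜ : Finset {j // j ∈ I0})) => p j ω) P :=
    hS.comp (φ := fun y : S → ℝ => y ⟨⟨i, hi⟩, Finset.mem_singleton_self _⟩) (ψ := id)
      (measurable_pi_apply _) measurable_id
  have hXYZ : IndepFun (fun ω => (p i ω, fun j : (Sᶜ : Finset {j // j ∈ I0}) => p j ω))
      (fun ω (j : {j // j ∉ I0}) => p j ω) P :=
    h.indep_blocks.comp (φ := fun y : {j // j ∈ I0} → ℝ =>
      (y ⟨i, hi⟩, fun j : (Sᶜ : Finset {j // j ∈ I0}) => y j)) (ψ := id)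
      ((measurable_pi_apply _).prodMk (measurable_pi_lambda _ fun j => measurable_pi_apply _))
      measurable_id
  have := IndepFun.prodMk_of_indepFun_prodMk hX hY hZ hXY hXYZ
  let ψ : ((Sᶜ : Finset {j // j ∈ I0}) → ℝ) × ({j // j ∉ I0} → ℝ) → {j // j ≠ i} → ℝ :=
    fun q j => if hj : (j : Fin m) ∈ I0 then
      q.1 ⟨⟨j, hj⟩, by simpa [S] using j.2⟩ else q.2 ⟨j, hj⟩
  have hψ : Measurable ψ := by
    refine measurable_pi_lambda _ fun j => ?_
    by_cases hj : (j : Fin m) ∈ I0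
    · simp only [ψ, dif_pos hj]
      exact (measurable_pi_apply _).comp measurable_fst
    · simp only [ψ, dif_neg hj]
      exact (measurable_pi_apply _).comp measurable_snd
  have h2 := this.comp (φ := id) measurable_id hψ
  convert! h2 using 1
  ext ω j
  by_cases hj : (j : Fin m) ∈ I0 <;> simp [ψ, hj]

/-- The joint law of `p i` and the remaining p-values is a product with uniform first factor, so the
formula is Tonelli's theorem after gluing the coordinates together. -/
lemma IsBI.isUniformCoord [IsProbabilityMeasure P] (h : IsBI P I0 p) {i : Fin m} (hi : i ∈ I0) :
    IsUniformCoord (P.map fun ω i => p i ω) i := by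
  classical
  intro f hf
  have hO : Measurable fun ω (j : {j // j ≠ i}) => p j ω :=
    measurable_pi_lambda _ fun j => h.measurable j
  have := Measure.isProbabilityMeasure_map (μ := P) hO.aemeasurable
  let glue : ℝ × ({j // j ≠ i} → ℝ) → Fin m → ℝ := fun q j =>
    if hj : j = i then q.1 else q.2 ⟨j, hj⟩
  have hglue : Measurable glue := by
    refine measurable_pi_lambda _ fun j => ?_
    by_cases hj : j = i
    · simp only [glue, dif_pos hj]
      exact measurable_fst
    · simp only [glue, dif_neg hj]
      exact (measurable_pi_apply _).comp measurable_snd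
  have hupd : ∀ (ω : Ω) (t : ℝ),
      Function.update (fun j => p j ω) i t = glue (t, fun j => p j ω) := by
    intro ω t
    ext j
    rcases eq_or_ne j i with rfl | hj
    · simp [glue]
    · simp [glue, hj]
  have hself : ∀ ω, (fun j => p j ω) = glue (p i ω, fun j => p j ω) := by
    intro ω
    rw [← hupd ω (p i ω)]
    exact (Function.update_eq_self i (fun j => p j ω)).symm
  have hF : Measurable fun x : Fin m → ℝ =>
      ∫⁻ t in Set.Icc (0 : ℝ) 1, f (Function.update x i t) := by
    refine Measurable.lintegral_prod_right' (f := fun q : (Fin m → ℝ) × ℝ =>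
      f (Function.update q.1 i q.2)) (hf.comp ?_)
    refine measurable_pi_lambda _ fun j => ?_
    rcases eq_or_ne j i with rfl | hj
    · simpa using measurable_snd
    · simp only [Function.update_of_ne hj]
      exact (measurable_pi_apply j).comp measurable_fst
  rw [lintegral_map hf h.measurable_vec, lintegral_map hF h.measurable_vec]
  calc ∫⁻ ω, f (fun j => p j ω) ∂P
      = ∫⁻ ω, f (glue (p i ω, fun j : {j // j ≠ i} => p j ω)) ∂P :=
        lintegral_congr fun ω => congrArg f (hself ω)
    _ = ∫⁻ q, f (glue q) ∂(P.map fun ω => (p i ω, fun j : {j // j ≠ i} => p j ω)) := by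
        exact (lintegral_map (hf.comp hglue) ((h.measurable i).prodMk hO)).symm
    _ = ∫⁻ q, f (glue q) ∂((volume.restrict (Set.Icc (0 : ℝ) 1)).prod
          (P.map fun ω (j : {j // j ≠ i}) => p j ω)) := by
        rw [(indepFun_iff_map_prod_eq_prod_map_map (h.measurable i).aemeasurable
          hO.aemeasurable).1 (h.indepFun_others hi), h.map_eq hi]
    _ = ∫⁻ y, (∫⁻ t in Set.Icc (0 : ℝ) 1, f (glue (t, y)))
          ∂(P.map fun ω (j : {j // j ≠ i}) => p j ω) :=
        lintegral_prod_symm' _ (hf.comp hglue)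
    _ = ∫⁻ ω, (∫⁻ t in Set.Icc (0 : ℝ) 1, f (glue (t, fun j : {j // j ≠ i} => p j ω))) ∂P :=
        lintegral_map (hf.comp hglue).lintegral_prod_left' hO
    _ = _ := by simp_rw [hupd]

/-- At least half of the expected number of true nulls have p-values below `lam`, up to a
probability of order `1 / m₀`. -/
lemma IsBI.measure_countLE_lt [IsProbabilityMeasure P] (h : IsBI P I0 p) {lam : ℝ}
    (hlam : 0 < lam) (hlam1 : lam ≤ 1) (hI0 : 0 < I0.card) :
    P {ω | (countLE (fun i => p i ω) lam : ℝ) < I0.card * (lam / 2)} ≤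
      ENNReal.ofReal (1 / (I0.card * lam ^ 2)) := by
  classical
  let φ : ℝ → ℝ := (Set.Iic lam).indicator 1
  have hφ : Measurable φ := measurable_one.indicator measurableSet_Iic
  let X : {i // i ∈ I0} → Ω → ℝ := fun i ω => φ (p i ω)
  have hXm : ∀ i, Measurable (X i) := fun i => hφ.comp (h.measurable i)
  have hX01 : ∀ i ω, X i ω ∈ Set.Icc (0 : ℝ) 1 := by
    intro i ω
    by_cases hi : p i ω ≤ lam <;> simp [X, φ, hi]
  have hL2 : ∀ i, MemLp (X i) 2 P := fun i =>
    MemLp.of_bound (hXm i).aestronglyMeasurable 1 (ae_of_all _ fun ω => by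
      rw [Real.norm_of_nonneg (hX01 i ω).1]; exact (hX01 i ω).2)
  have hmean : ∀ i, ∫ ω, X i ω ∂P = lam := by
    intro i
    have : X i = {ω | p i ω ≤ lam}.indicator 1 := by
      ext ω
      by_cases hi : p i ω ≤ lam <;> simp [X, φ, hi]
    rw [this, integral_indicator_one (measurableSet_le (h.measurable i) measurable_const),
      measureReal_def, h.unif_null i i.2 lam ⟨hlam.le, hlam1⟩, ENNReal.toReal_ofReal hlam.le]
  have hindep : iIndepFun X P := h.indep_null.comp (fun _ => φ) fun _ => hφ
  -- A variable with values in `[0, 1]` has variance at most `1 / 4`.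
  have hvar : Var[∑ i, X i; P] ≤ I0.card * (1 / 4) := by
    rw [IndepFun.variance_sum (fun i _ => hL2 i) fun i _ j _ hij => hindep.indepFun hij]
    calc ∑ i, Var[X i; P] ≤ ∑ _i : {i // i ∈ I0}, ((1 - 0) / 2 : ℝ) ^ 2 :=
          Finset.sum_le_sum fun i _ =>
            variance_le_sq_of_bounded (ae_of_all _ (hX01 i)) (hXm i).aemeasurable
      _ = I0.card * (1 / 4) := by simp; norm_num
  have hE : P[∑ i, X i] = I0.card * lam := by
    simp only [Finset.sum_apply]
    rw [integral_finsetSum _ fun i _ => (hL2 i).integrable one_le_two]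
    simp [hmean]
  have hc : (0 : ℝ) < I0.card * (lam / 2) := by positivity
  have hsum : ∀ ω, (∑ i, X i) ω ≤ countLE (fun i => p i ω) lam := by
    intro ω
    rw [Finset.sum_apply]
    change ∑ i : {i // i ∈ I0}, φ (p i ω) ≤ _
    rw [Finset.sum_coe_sort I0 fun i => φ (p i ω)]
    calc ∑ i ∈ I0, φ (p i ω) ≤ ∑ i, φ (p i ω) :=
          Finset.sum_le_sum_of_subset_of_nonneg (Finset.subset_univ _) fun i _ _ =>
            Set.indicator_nonneg (fun _ _ => zero_le_one) _
      _ = _ := by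
        simp [countLE, φ, Set.indicator_apply]
  calc P {ω | (countLE (fun i => p i ω) lam : ℝ) < I0.card * (lam / 2)}
      ≤ P {ω | I0.card * (lam / 2) ≤ |(∑ i, X i) ω - P[∑ i, X i]|} := by
        refine measure_mono fun ω hω => ?_
        have h1 := hsum ω
        have h2 : (countLE (fun i => p i ω) lam : ℝ) < I0.card * (lam / 2) := hω
        rw [Set.mem_ofPred_eq]
        rw [hE, abs_sub_comm]
        refine le_trans ?_ (le_abs_self _)
        linarith
    _ ≤ ENNReal.ofReal (Var[∑ i, X i; P] / (I0.card * (lam / 2)) ^ 2) :=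
        meas_ge_le_variance_div_sq (memLp_finsetSum' _ fun i _ => hL2 i) hc
    _ ≤ _ := by
        refine ENNReal.ofReal_le_ofReal ?_
        calc Var[∑ i, X i; P] / (I0.card * (lam / 2)) ^ 2
            ≤ I0.card * (1 / 4) / (I0.card * (lam / 2)) ^ 2 := by gcongr
          _ = _ := by field_simp; norm_num

end Independence

end AdaptiveStepUp
namespace AdaptiveStepUp

open scoped ENNReal

/-! ### Passing to estimators with bounds at every vector -/

lemma adaptiveCrit_congr {α lam : ℝ} {m : ℕ} {g g' : (Set.Ici lam → ℝ) → ℝ} {x : Fin m → ℝ}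
    (h : g' (ecdfTail lam x) = g (ecdfTail lam x)) :
    adaptiveCrit α lam g' x = adaptiveCrit α lam g x := by
  unfold adaptiveCrit; rw [h]

lemma numRej_congr {α lam : ℝ} {m : ℕ} {g g' : (Set.Ici lam → ℝ) → ℝ} {x : Fin m → ℝ}
    (h : g' (ecdfTail lam x) = g (ecdfTail lam x)) :
    numRej α lam g' x = numRej α lam g x := by
  unfold numRej; rw [adaptiveCrit_congr h]

lemma numFalseRej_congr {α lam : ℝ} {m : ℕ} {g g' : (Set.Ici lam → ℝ) → ℝ} {x : Fin m → ℝ}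
    (I0 : Finset (Fin m)) (h : g' (ecdfTail lam x) = g (ecdfTail lam x)) :
    numFalseRej α lam g' I0 x = numFalseRej α lam g I0 x := by
  unfold numFalseRej; rw [adaptiveCrit_congr h]

/-- An estimator can be modified off the p-values that satisfy its bounds so as to be admissible. -/
lemma exists_isAdmissible {α lam K : ℝ} {m : ℕ} (hm : 1 ≤ m) (hα : 0 < α) (hαlam : α ≤ lam)
    {g : (Set.Ici lam → ℝ) → ℝ} (hg : Measurable g) :
    ∃ g' : (Set.Ici lam → ℝ) → ℝ, IsAdmissible α lam (max K 1) m g' ∧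
      ∀ x : Fin m → ℝ, 0 < g (ecdfTail lam x) →
        (countLE x lam : ℝ) ≤ lam / α * g (ecdfTail lam x) → g (ecdfTail lam x) ≤ K * m →
        g' (ecdfTail lam x) = g (ecdfTail lam x) := by
  classical
  have hm0 : (0 : ℝ) < m := by exact_mod_cast hm
  have hcount : ∀ x : Fin m → ℝ,
      (m : ℝ) * ecdfTail lam x ⟨lam, Set.self_mem_Ici⟩ = countLE x lam := by
    intro x
    simp only [ecdfTail, ecdf]
    field_simp
  let good : (Set.Ici lam → ℝ) → Prop := fun F =>
    0 < g F ∧ (m : ℝ) * F ⟨lam, Set.self_mem_Ici⟩ ≤ lam / α * g F ∧ g F ≤ K * m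
  have hF : Measurable fun F : Set.Ici lam → ℝ => (m : ℝ) * F ⟨lam, Set.self_mem_Ici⟩ :=
    (measurable_pi_apply _).const_mul _
  have hgood : MeasurableSet {F | good F} :=
    (measurableSet_lt measurable_const hg).inter
      ((measurableSet_le hF (hg.const_mul (lam / α))).inter (measurableSet_le hg measurable_const))
  have hK : 1 ≤ max K 1 := le_max_right _ _
  -- The bounds are assumed only at realised p-values, but resampling visits other vectors. The
  -- fallback `max K 1 * m` meets the lower bound because at most `m` p-values are counted and `α ≤
  -- lam`.
  refine ⟨fun F => if good F then g F else max K 1 * m,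
    ⟨Measurable.ite hgood hg measurable_const, fun x => ?_, fun x => ?_, fun x => ?_⟩,
    fun x h1 h2 h3 => if_pos ⟨h1, by rwa [hcount], h3⟩⟩
  · by_cases h : good (ecdfTail lam x)
    · simpa only [if_pos h] using h.1
    · simp only [if_neg h]; positivity
  · by_cases h : good (ecdfTail lam x)
    · simpa only [if_pos h, hcount] using h.2.1
    · simp only [if_neg h]
      have h1 : (countLE x lam : ℝ) ≤ m := by exact_mod_cast countLE_le x lam
      have h2 : 1 ≤ lam / α := (one_le_div hα).2 hαlam
      calc (countLE x lam : ℝ) ≤ 1 * (1 * m) := by linarith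
        _ ≤ lam / α * (max K 1 * m) := by gcongr
  · by_cases h : good (ecdfTail lam x)
    · simp only [if_pos h]
      exact h.2.2.trans (by gcongr; exact le_max_left _ _)
    · simp only [if_neg h]; exact le_rfl

section Model

variable {Ω : Type*} [MeasurableSpace Ω] {P : Measure Ω} [IsProbabilityMeasure P] {m : ℕ}
  {I0 : Finset (Fin m)} {p : Fin m → Ω → ℝ} {α lam K : ℝ} {g : (Set.Ici lam → ℝ) → ℝ}

lemma IsBI.le_integral_fdp (h : IsBI P I0 p) (hm : 1 ≤ m) (hα : 0 < α) (hαlam : α ≤ lam)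
    (hlam1 : lam < 1) (hg : Measurable g)
    (hpos : ∀ ω, 0 < g (ecdfTail lam fun i => p i ω))
    (hlow : ∀ ω, (countLE (fun i => p i ω) lam : ℝ) ≤
      lam / α * g (ecdfTail lam fun i => p i ω))
    (hup : ∀ ω, g (ecdfTail lam fun i => p i ω) ≤ K * m) :
    I0.card / m * (α / max K 1) ≤ ∫ ω, fdp α lam g I0 (fun i => p i ω) ∂P := by
  obtain ⟨g', hg', heq⟩ := exists_isAdmissible (K := K) hm hα hαlam hg
  have heq' := fun ω => heq (fun i => p i ω) (hpos ω) (hlow ω) (hup ω)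
  have hμ := Measure.isProbabilityMeasure_map (μ := P) h.measurable_vec.aemeasurable
  have key := hg'.le_integral_fdp (μ := P.map fun ω i => p i ω) hα (hα.le.trans hαlam) hlam1
    fun i hi => h.isUniformCoord hi
  rw [integral_map h.measurable_vec.aemeasurable
    (hg'.measurable_fdp I0).aestronglyMeasurable] at key
  have hfdp : ∀ ω, fdp α lam g' I0 (fun i => p i ω) = fdp α lam g I0 fun i => p i ω := fun ω => by
    unfold fdp
    rw [numRej_congr (heq' ω), numFalseRej_congr I0 (heq' ω)]
  simp_rw [hfdp] at key
  refine le_trans (le_of_eq ?_) key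
  have : (0 : ℝ) < m := by exact_mod_cast hm
  have : 0 < max K 1 := lt_max_of_lt_right one_pos
  field_simp

lemma IsBI.measure_numRej_le (h : IsBI P I0 p) (hm : 1 ≤ m) (hα : 0 < α) (hαlam : α ≤ lam)
    (hlam1 : lam < 1) (hg : Measurable g)
    (hpos : ∀ ω, 0 < g (ecdfTail lam fun i => p i ω))
    (hlow : ∀ ω, (countLE (fun i => p i ω) lam : ℝ) ≤
      lam / α * g (ecdfTail lam fun i => p i ω))
    (hup : ∀ ω, g (ecdfTail lam fun i => p i ω) ≤ K * m) {C : ℝ} (hC : 0 ≤ C)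
    (hI0 : 0 < I0.card) (hCI : 2 * C ≤ I0.card * (lam / 2)) :
    P {ω | (numRej α lam g (fun i => p i ω) : ℝ) ≤ C} ≤
      ENNReal.ofReal (Real.exp (4 * C / lam)) *
        P {ω | numFalseRej α lam g I0 (fun i => p i ω) = 0} +
      ENNReal.ofReal (1 / (I0.card * lam ^ 2)) := by
  have hlam : 0 < lam := hα.trans_le hαlam
  obtain ⟨g', hg', heq⟩ := exists_isAdmissible (K := K) hm hα hαlam hg
  have heq' := fun ω => heq (fun i => p i ω) (hpos ω) (hlow ω) (hup ω)
  have hμ := Measure.isProbabilityMeasure_map (μ := P) h.measurable_vec.aemeasurable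
  have hn : (0 : ℝ) < I0.card * (lam / 2) := by positivity
  have key := hg'.measure_numRej_le (μ := P.map fun ω i => p i ω) hα hlam1 hC hn hCI hlam
    fun i hi => h.isUniformCoord hi
  have hR : Measurable fun x : Fin m → ℝ => (numRej α lam g' x : ℝ) :=
    measurable_from_nat.comp hg'.measurable_numRej
  have hcount : Measurable fun x : Fin m → ℝ => (countLE x lam : ℝ) :=
    measurable_from_nat.comp (measurable_countLE lam)
  rw [Measure.map_apply h.measurable_vec (measurableSet_le hR measurable_const),
    Measure.map_apply h.measurable_vec (measurableSet_lt hcount measurable_const),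
    Measure.map_apply h.measurable_vec
      (measurableSet_eq_fun (hg'.measurable_numFalseRej I0) measurable_const)] at key
  simp only [Set.preimage_ofPred_eq, fun ω => numRej_congr (α := α) (heq' ω),
    fun ω => numFalseRej_congr (α := α) I0 (heq' ω)] at key
  -- With `n = m₀ lam / 2` the number of nulls cancels from the exponent.
  have hexp : (I0.card : ℝ) * (2 * C / (I0.card * (lam / 2))) = 4 * C / lam := by
    have : (0 : ℝ) < I0.card := by exact_mod_cast hI0
    field_simp
    ring
  rw [hexp] at key
  exact key.trans (by gcongr; exact h.measure_countLE_lt hlam hlam1.le hI0)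

end Model

/-! ### Consistency and the conclusion -/

/-- If the proportions `V / R` are consistent with expectations bounded away from zero, and `R` is
rarely small except when `V` vanishes, then `V` and `R` tend to infinity in probability. -/
lemma tendstoInftyInProb_of_consistent {Ω : ℕ → Type*} [∀ m, MeasurableSpace (Ω m)]
    {P : ∀ m, Measure (Ω m)} {R V : ∀ m, Ω m → ℕ}
    (hcons : Consistent P fun m ω => (V m ω : ℝ) / R m ω) {c : ℝ} (hc : 0 < c)
    (hE : ∀ᶠ m in atTop, c ≤ ∫ ω, (V m ω : ℝ) / R m ω ∂(P m)) {D : ℝ → ℝ≥0∞}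
    (hD : ∀ C, D C ≠ ∞) {e : ℕ → ℝ≥0∞} (he : Tendsto e atTop (𝓝 0))
    (hR : ∀ C, 0 ≤ C → ∀ᶠ m in atTop,
      P m {ω | (R m ω : ℝ) ≤ C} ≤ D C * P m {ω | V m ω = 0} + e m) :
    TendstoInftyInProb P (fun m ω => (V m ω : ℝ)) ∧
      TendstoInftyInProb P (fun m ω => (R m ω : ℝ)) := by
  have hV0 : Tendsto (fun m => P m {ω | V m ω = 0}) atTop (𝓝 0) := by
    refine tendsto_of_tendsto_of_tendsto_of_le_of_le' tendsto_const_nhds (hcons c hc)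
      (Eventually.of_forall fun _ => zero_le) ?_
    filter_upwards [hE] with m hm
    refine measure_mono fun ω hω => ?_
    have hω0 : V m ω = 0 := hω
    simp only [Set.mem_ofPred_eq, hω0, Nat.cast_zero, zero_div, zero_sub, abs_neg]
    exact hm.trans (le_abs_self _)
  have hRpos : ∀ C, 0 ≤ C → Tendsto (fun m => P m {ω | (R m ω : ℝ) ≤ C}) atTop (𝓝 0) := by
    intro C hC
    refine tendsto_of_tendsto_of_tendsto_of_le_of_le' tendsto_const_nhds ?_
      (Eventually.of_forall fun _ => zero_le) (hR C hC)
    simpa using (ENNReal.Tendsto.const_mul hV0 (Or.inr (hD C))).add he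
  refine ⟨fun C => ?_, fun C => ?_⟩
  -- If `V ≤ C` and `R > 2 * max C 0 / c`, then `V / R ≤ c / 2`, a deviation of at least `c / 2`
  -- from a mean that is at least `c`.
  · have hlim := (hRpos (2 * max C 0 / c) (by positivity)).add (hcons (c / 2) (by positivity))
    rw [add_zero] at hlim
    refine tendsto_of_tendsto_of_tendsto_of_le_of_le' tendsto_const_nhds hlim
      (Eventually.of_forall fun _ => zero_le) ?_
    filter_upwards [hE] with m hm
    refine (measure_mono fun ω hω => ?_).trans (measure_union_le _ _)
    rcases le_or_gt (R m ω : ℝ) (2 * max C 0 / c) with h | h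
    · exact Or.inl h
    · refine Or.inr ?_
      have hVC : (V m ω : ℝ) ≤ max C 0 := le_max_of_le_left hω
      have hR0 : (0 : ℝ) < R m ω := lt_of_le_of_lt (by positivity) h
      have hq : (V m ω : ℝ) / R m ω ≤ c / 2 := by
        rw [div_lt_iff₀ hc] at h
        rw [div_le_iff₀ hR0]
        linarith
      simp only [Set.mem_ofPred_eq]
      rw [abs_sub_comm]
      exact le_trans (by linarith) (le_abs_self _)
  · refine tendsto_of_tendsto_of_tendsto_of_le_of_le tendsto_const_nhds
      (hRpos (max C 0) (le_max_right _ _)) (fun _ => zero_le)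
      fun m => measure_mono fun ω (hω : (R m ω : ℝ) ≤ C) =>
        (le_max_of_le_left hω : (R m ω : ℝ) ≤ max C 0)

end AdaptiveStepUp

theorem theorem4p4
    {Ω : ℕ → Type*} [∀ m, MeasurableSpace (Ω m)]
    (P : ∀ m, Measure (Ω m)) [∀ m, IsProbabilityMeasure (P m)]
    (I0 : ∀ m, Finset (Fin m)) (p : ∀ m, Fin m → Ω m → ℝ)
    (hBI : ∀ m, 1 ≤ m → AdaptiveStepUp.IsBI (P m) (I0 m) (p m))
    (α₁ α₂ lam : ℝ) (hα₁ : 0 < α₁) (hα : α₁ < α₂) (hα₂ : α₂ ≤ lam) (hlam : lam < 1)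
    -- the estimators of the number of true nulls, one for each `m` and each level `α`
    (g : ℕ → ℝ → (Set.Ici lam → ℝ) → ℝ)
    (hg : ∀ m, 1 ≤ m → ∀ α ∈ Set.Ioo α₁ α₂, Measurable (g m α))
    -- the proportion of true nulls converges
    (κ₀ : ℝ) (hκ₀ : κ₀ ∈ Set.Ioc (0 : ℝ) 1)
    (hA1 : Tendsto (fun m => ((I0 m).card : ℝ) / (m : ℝ)) atTop (𝓝 κ₀))
    -- the estimators are positive and bounded below by `(α / lam) R_m(lam)`
    (hA2 : ∀ α ∈ Set.Ioo α₁ α₂, ∀ m, 1 ≤ m → ∀ ω : Ω m,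
      0 < g m α (AdaptiveStepUp.ecdfTail lam fun i => p m i ω) ∧
      (AdaptiveStepUp.countLE (fun i => p m i ω) lam : ℝ) ≤
        lam / α * g m α (AdaptiveStepUp.ecdfTail lam fun i => p m i ω))
    -- the estimators are at most of order `m`
    (hA3 : ∀ α ∈ Set.Ioo α₁ α₂, ∃ K : ℝ, 0 < K ∧ ∀ m, 1 ≤ m → ∀ ω : Ω m,
      g m α (AdaptiveStepUp.ecdfTail lam fun i => p m i ω) ≤ K * m)
    -- consistency at every level
    (hcons : ∀ α ∈ Set.Ioo α₁ α₂, AdaptiveStepUp.Consistent P fun m ω =>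
      AdaptiveStepUp.fdp α lam (g m α) (I0 m) fun i => p m i ω) :
    ∀ α ∈ Set.Ioo α₁ α₂,
      AdaptiveStepUp.TendstoInftyInProb P (fun m ω =>
        (AdaptiveStepUp.numFalseRej α lam (g m α) (I0 m) (fun i => p m i ω) : ℝ)) ∧
      AdaptiveStepUp.TendstoInftyInProb P (fun m ω =>
        (AdaptiveStepUp.numRej α lam (g m α) (fun i => p m i ω) : ℝ)) := by
  intro α hαmem
  have hα0 : 0 < α := hα₁.trans hαmem.1
  have hαlam : α ≤ lam := hαmem.2.le.trans hα₂
  have hlam0 : 0 < lam := hα0.trans_le hαlam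
  obtain ⟨K, -, hK⟩ := hA3 α hαmem
  have hκ : 0 < κ₀ := hκ₀.1
  have hcard : Tendsto (fun m => ((I0 m).card : ℝ)) atTop atTop := by
    refine (hA1.pos_mul_atTop hκ tendsto_natCast_atTop_atTop).congr' ?_
    filter_upwards [eventually_ge_atTop 1] with m hm
    have : (0 : ℝ) < m := by exact_mod_cast hm
    field_simp
  have hβ : 0 < α / max K 1 := div_pos hα0 (lt_max_of_lt_right one_pos)
  refine AdaptiveStepUp.tendstoInftyInProb_of_consistent
    (R := fun m ω => AdaptiveStepUp.numRej α lam (g m α) fun i => p m i ω)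
    (V := fun m ω => AdaptiveStepUp.numFalseRej α lam (g m α) (I0 m) fun i => p m i ω)
    (hcons α hαmem) (c := κ₀ / 2 * (α / max K 1)) (by positivity) ?_
    (D := fun C => ENNReal.ofReal (Real.exp (4 * C / lam))) (fun _ => ENNReal.ofReal_ne_top)
    (e := fun m => ENNReal.ofReal (1 / ((I0 m).card * lam ^ 2))) ?_ ?_
  -- Eventually `m₀ / m > κ₀ / 2`, which explains the constant `c`.
  · filter_upwards [eventually_ge_atTop 1, hA1.eventually (lt_mem_nhds (half_lt_self hκ))]
      with m hm hcm
    exact (mul_le_mul_of_nonneg_right hcm.le hβ.le).trans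
      ((hBI m hm).le_integral_fdp hm hα0 hαlam hlam (hg m hm α hαmem)
        (fun ω => (hA2 α hαmem m hm ω).1) (fun ω => (hA2 α hαmem m hm ω).2) (hK m hm))
  · rw [← ENNReal.ofReal_zero]
    refine ENNReal.tendsto_ofReal ?_
    simp_rw [one_div]
    exact (hcard.atTop_mul_const (by positivity)).inv_tendsto_atTop
  · intro C hC
    filter_upwards [eventually_ge_atTop 1, hcard.eventually_gt_atTop 0,
      hcard.eventually_ge_atTop (2 * C / (lam / 2))] with m hm hpos hCm
    exact (hBI m hm).measure_numRej_le hm hα0 hαlam hlam (hg m hm α hαmem)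
      (fun ω => (hA2 α hαmem m hm ω).1) (fun ω => (hA2 α hαmem m hm ω).2) (hK m hm) hC
      (by exact_mod_cast hpos) ((div_le_iff₀ (by positivity)).1 hCm)
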